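/- Let $\mathbf{Q}$ be a property of finite groups, invariant under isomorphism, which is held by at least one finite group and is inherited by all normal sections (that is, if $G$ has $\mathbf{Q}$, $H\lhd G$ and $K\lhd H$, then $H/K$ has $\mathbf{Q}$). For a finite group $G$ let $F(G)$ be its Fitting subgroup, the subgroup generated by all nilpotent normal subgroups of $G$. Define the sets of real numbers $$A(\mathbf{Q})=\{[G:F(G)]^{\frac1{n-1}} : n\ge 2,\ G \text{ is a finite subgroup of } \mathrm{GL}(n,\mathbb{C}) \text{ with property } \mathbf{Q}\},$$ $$B(\mathbf{Q})=\{|G|^{\frac1{n-1}} : n\ge 2,\ G\le \mathrm{Sym}_n,\ G \text{ has property } \mathbf{Q}\},$$ $$C(\mathbf{Q})=\{[G:A]^{\frac1{n-1}} : n\ge 2,\ G \text{ is a finite subgroup of } \mathrm{GL}(n,\mathbb{C}) \text{ with property } \mathbf{Q},\ A \text{ is an Abelian normal subgroup of } G \text{ of maximal order}\}.$$ Then $A(\mathbf{Q})$ is bounded above if and only if $C(\mathbf{Q})$ is bounded above. If either of these sets is bounded above, then $B(\mathbf{Q})$ is bounded above, and the least upper bounds $\alpha$, $\beta$, $\gamma$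 of $A(\mathbf{Q})$, $B(\mathbf{Q})$, $C(\mathbf{Q})$ respectively exist and satisfy $\beta\le 2\alpha$ and $\gamma\le 4\alpha$. -/

import Mathlib

/-- A property of finite groups. (Every finite group is isomorphic to one in `Type`, and the
properties considered are invariant under isomorphism.) -/
def FiniteGroupProperty : Type 1 :=
  (G : Type) → [Group G] → [Finite G] → Prop

/-- The property `Q` is isomorphism invariant and is inherited by all normal sections, that is, by
all groups `H ⧸ K` with `H` normal in `G` and `K` normal in `H`. -/
structure IsNormallyHereditary (Q : FiniteGroupProperty) : Prop where
  of_mulEquiv : ∀ (G H : Type) [Group G] [Finite G] [Group H] [Finite H],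
    Nonempty (G ≃* H) → Q G → Q H
  of_normalSection : ∀ (G : Type) [Group G] [Finite G] (H : Subgroup G) [H.Normal]
    (K : Subgroup H) [K.Normal], Q G → Q (H ⧸ K)

/-- At least one finite group has property `Q`. -/
def IsExtant (Q : FiniteGroupProperty) : Prop :=
  ∃ (G : Type) (_ : Group G) (_ : Finite G), Q G

/-- The subgroup generated by all nilpotent normal subgroups; for a finite group this is the
Fitting subgroup. -/
def fittingSubgroup (G : Type*) [Group G] : Subgroup G :=
  sSup {N : Subgroup G | N.Normal ∧ Group.IsNilpotent N}

/-- `A` is an Abelian normal subgroup of (the finite group) `G`, of maximal order among all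
Abelian normal subgroups of `G`. -/
def IsMaxOrderAbelianNormal {G : Type*} [Group G] (A : Subgroup G) : Prop :=
  (A.Normal ∧ IsMulCommutative A) ∧
    ∀ A' : Subgroup G, A'.Normal → IsMulCommutative A' → Nat.card A' ≤ Nat.card A

/-- The numbers `[G : F(G)] ^ (1 / (n - 1))` for `n ≥ 2` and `G` a finite subgroup of `GL(n, ℂ)`
with property `Q`. -/
def setA (Q : FiniteGroupProperty) : Set ℝ :=
  {x | ∃ n : ℕ, 2 ≤ n ∧ ∃ (G : Subgroup (Matrix.GeneralLinearGroup (Fin n) ℂ)) (_ : Finite G),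
    Q G ∧ x = ((fittingSubgroup G).index : ℝ) ^ (1 / ((n : ℝ) - 1))}

/-- The numbers `|G| ^ (1 / (n - 1))` for `n ≥ 2` and `G` a subgroup of the symmetric group of
degree `n` with property `Q`. -/
def setB (Q : FiniteGroupProperty) : Set ℝ :=
  {x | ∃ n : ℕ, 2 ≤ n ∧ ∃ G : Subgroup (Equiv.Perm (Fin n)),
    Q G ∧ x = (Nat.card G : ℝ) ^ (1 / ((n : ℝ) - 1))}

/-- The numbers `[G : A] ^ (1 / (n - 1))` for `n ≥ 2`, `G` a finite subgroup of `GL(n, ℂ)` with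
property `Q`, and `A` an Abelian normal subgroup of `G` of maximal order. -/
def setC (Q : FiniteGroupProperty) : Set ℝ :=
  {x | ∃ n : ℕ, 2 ≤ n ∧ ∃ (G : Subgroup (Matrix.GeneralLinearGroup (Fin n) ℂ)) (_ : Finite G),
    Q G ∧ ∃ A : Subgroup G, IsMaxOrderAbelianNormal A ∧
      x = (A.index : ℝ) ^ (1 / ((n : ℝ) - 1))}

/-!
The sets are compared element by element.

* An abelian normal subgroup of maximal order lies in the Fitting subgroup, so every element of
  `setA Q` is at most some element of `setC Q`.
* If `G ≤ GL(n, ℂ)` is finite, then `F(G)` is nilpotent (`isNilpotent_fittingSubgroup`), so it has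
  an abelian subgroup of index at most `2 ^ (n - 1)` (`Representation.exists_index_le_comm`). The
  Chermak–Delgado argument (`Subgroup.exists_characteristic_isMulCommutative`) replaces it by a
  characteristic abelian subgroup of index at most `4 ^ (n - 1)`, which is normal in `G`. Hence
  `[G : A] ≤ 4 ^ (n - 1) * [G : F(G)]`, and every element of `setC Q` is at most `4` times an
  element of `setA Q`.
* A group `G ≤ Sym_n` is isomorphic to a group of permutation matrices, and its nilpotent subgroup
  `F(G)` has order at most `2 ^ (n - 1)` (`Group.IsNilpotent.card_le_two_pow`). Hence
  `|G| ≤ 2 ^ (n - 1) * [G : F(G)]`, and every element of `setB Q` is at most `2` times an element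
  of `setA Q`.

The sets are nonempty because the trivial group, as a normal section, has property `Q`.

Both bounds for nilpotent groups are proved by induction on the degree, using a subgroup of index
at most `k` that preserves a partition into `k ≥ 2` pieces; since `k ≤ 2 ^ (k - 1)`, the bounds for
the pieces combine (`Subgroup.index_map_iInf_le_two_pow`). For permutations the pieces are orbits,
or the orbits of a maximal subgroup containing a point stabilizer, which is normal. For linear
actions they are the eigenspaces of an element commuting with the image up to scalars, which comes
from the lower central series; its centralizer preserves them.
-/

/-! ### Combining subgroups along a partition -/

/-- The numerical step shared by permutation and linear groups: if `M` has index at most `|S|` and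
acts separately on pieces of size `d s`, with total size at most `n`, then bounds `2 ^ (d s - 1)`
for the pieces combine to the bound `2 ^ (n - 1)`. -/
theorem Subgroup.index_map_iInf_le_two_pow {G : Type*} [Group G] (M : Subgroup G)
    {S : Type*} [Finite S] [Nonempty S] (K : S → Subgroup M) (d : S → ℕ) (n : ℕ)
    (hM : M.index ≤ Nat.card S) (hd : ∀ s, 1 ≤ d s) (hK : ∀ s, (K s).index ≤ 2 ^ (d s - 1))
    (hn : ∑ᶠ s, d s ≤ n) :
    ((⨅ s, K s).map M.subtype).index ≤ 2 ^ (n - 1) := by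
  have := Fintype.ofFinite S
  rw [finsum_eq_sum_of_fintype] at hn
  have hcard : Nat.card S + ∑ s, (d s - 1) = ∑ s, d s := by
    rw [Nat.card_eq_fintype_card, Fintype.card_eq_sum_ones, ← Finset.sum_add_distrib]
    exact Finset.sum_congr rfl fun s _ => by have := hd s; omega
  -- With `k = |S|`: `k ≤ 2 ^ (k - 1)`, and `k - 1 + ∑ (d s - 1) = ∑ d s - 1 ≤ n - 1`.
  have hpos : 0 < Nat.card S := Nat.card_pos
  have hlt : Nat.card S ≤ 2 ^ (Nat.card S - 1) := by
    have := Nat.lt_two_pow_self (n := Nat.card S - 1)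
    omega
  calc ((⨅ s, K s).map M.subtype).index = (⨅ s, K s).index * M.index :=
        Subgroup.index_map_subtype _
    _ ≤ (∏ s, 2 ^ (d s - 1)) * 2 ^ (Nat.card S - 1) :=
        Nat.mul_le_mul ((Subgroup.index_iInf_le K).trans
          (Finset.prod_le_prod' fun s _ => hK s)) (hM.trans hlt)
    _ = 2 ^ (∑ s, (d s - 1) + (Nat.card S - 1)) := by
        rw [Finset.prod_pow_eq_pow_sum, ← pow_add]
    _ ≤ 2 ^ (n - 1) := Nat.pow_le_pow_right two_pos (by omega)

/-! ### Nilpotent permutation groups -/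

/-- A transitive action of a finite nilpotent group on at least two points maps onto the cosets of a
proper subgroup `M`, normal since maximal and containing a point stabilizer, so that `M` preserves
each fibre. -/
theorem MulAction.exists_fibration_of_isNilpotent {G Ω : Type*} [Group G] [Finite G]
    [Group.IsNilpotent G] [MulAction G Ω] [MulAction.IsPretransitive G Ω] [Nontrivial Ω] :
    ∃ (M : Subgroup G) (f : Ω → G ⧸ M), M ≠ ⊤ ∧ Function.Surjective f ∧
      ∀ m ∈ M, ∀ ω, f (m • ω) = f ω := by
  obtain ⟨ω₀⟩ : Nonempty Ω := inferInstance
  have hne : MulAction.stabilizer G ω₀ ≠ ⊤ := by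
    intro h
    obtain ⟨ω₁, h₁⟩ := exists_ne ω₀
    obtain ⟨g, rfl⟩ := MulAction.exists_smul_eq G ω₀ ω₁
    have : g ∈ MulAction.stabilizer G ω₀ := h ▸ Subgroup.mem_top g
    exact h₁ this
  obtain ⟨M, hM, hle⟩ := (eq_top_or_exists_le_coatom (MulAction.stabilizer G ω₀)).resolve_left hne
  -- Maximal subgroups of nilpotent groups are normal.
  have hnorm : M.Normal :=
    Subgroup.NormalizerCondition.normal_of_coatom M Group.normalizerCondition_of_isNilpotent hM
  -- `f` is the inverse of `G ⧸ stabilizer G ω₀ ≃ Ω` followed by the projection to `G ⧸ M`.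
  choose g hg using fun ω : Ω => MulAction.exists_smul_eq G ω₀ ω
  have key : ∀ a b : G, a • ω₀ = b • ω₀ → (a : G ⧸ M) = b := by
    intro a b hab
    refine QuotientGroup.eq.2 (hle ?_)
    rw [MulAction.mem_stabilizer_iff, mul_smul, ← hab, inv_smul_smul]
  refine ⟨M, fun ω => (g ω : G ⧸ M), hM.1, ?_, ?_⟩
  · intro q
    obtain ⟨a, rfl⟩ := QuotientGroup.mk_surjective q
    exact ⟨a • ω₀, key _ _ (hg _)⟩
  · intro m hm ω
    have h := key (g (m • ω)) (m * g ω) (by rw [hg, mul_smul, hg])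
    change (g (m • ω) : G ⧸ M) = g ω
    rw [h, QuotientGroup.mk_mul, (QuotientGroup.eq_one_iff m).2 hm, one_mul]

/-- Induction step: a subgroup of index at most `|S|` that preserves the fibres of a surjection
`Ω → S` reduces the bound for `Ω` to the bounds for the fibres. -/
theorem exists_subgroup_index_le_fixing_of_fibration {G Ω S : Type*} [Group G] [MulAction G Ω]
    [Finite Ω] [Finite S] [Nontrivial S] (M : Subgroup G) (f : Ω → S)
    (hf : Function.Surjective f) (hfM : ∀ m ∈ M, ∀ ω, f (m • ω) = f ω)
    (hM : M.index ≤ Nat.card S)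
    (ih : ∀ X : SubMulAction M Ω, Nonempty X → Nat.card X < Nat.card Ω →
      ∃ K : Subgroup M, K.index ≤ 2 ^ (Nat.card X - 1) ∧ ∀ k ∈ K, ∀ x : X, k • x = x) :
    ∃ K : Subgroup G, K.index ≤ 2 ^ (Nat.card Ω - 1) ∧ ∀ k ∈ K, ∀ ω : Ω, k • ω = ω := by
  let X : S → SubMulAction M Ω := fun s =>
    { carrier := f ⁻¹' {s}
      smul_mem' := fun m ω h => (hfM m m.2 ω).trans h }
  have hX : ∀ s, Nonempty (X s) := fun s => let ⟨ω, h⟩ := hf s; ⟨⟨ω, h⟩⟩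
  have hlt : ∀ s, Nat.card (X s) < Nat.card Ω := by
    intro s
    obtain ⟨t, ht⟩ := exists_ne s
    obtain ⟨ω, rfl⟩ := hf t
    have : (f ⁻¹' {s}).ncard < (Set.univ : Set Ω).ncard :=
      Set.ncard_lt_ncard (Set.ssubset_univ_iff.2 fun h => ht (h ▸ Set.mem_univ ω : ω ∈ f ⁻¹' {s}))
    rwa [Set.ncard_univ] at this
  choose K hK hfix using fun s => ih (X s) (hX s) (hlt s)
  refine ⟨(⨅ s, K s).map M.subtype, Subgroup.index_map_iInf_le_two_pow M K
    (fun s => Nat.card (X s)) _ hM (fun s => ?_) hK ?_, ?_⟩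
  · exact Nat.card_pos
  · have := Fintype.ofFinite S
    rw [finsum_eq_sum_of_fintype, ← Nat.card_sigma]
    exact (Nat.card_congr (Equiv.sigmaFiberEquiv f)).le
  · rintro _ ⟨m, hm, rfl⟩ ω
    have h := hfix (f ω) m (Subgroup.mem_iInf.1 hm _) ⟨ω, rfl⟩
    exact congrArg Subtype.val h

/-- The kernel of the action of a finite nilpotent group on `n` points has index at most
`2 ^ (n - 1)`. -/
theorem exists_subgroup_index_le_fixing_of_isNilpotent {G Ω : Type*} [Group G] [Finite G]
    [hG : Group.IsNilpotent G] [MulAction G Ω] [Finite Ω] [Nonempty Ω] :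
    ∃ K : Subgroup G, K.index ≤ 2 ^ (Nat.card Ω - 1) ∧ ∀ k ∈ K, ∀ ω : Ω, k • ω = ω := by
  induction hn : Nat.card Ω using Nat.strong_induction_on generalizing G Ω with
  | _ n ih =>
  subst hn
  rcases subsingleton_or_nontrivial Ω with hΩ | hΩ
  · exact ⟨⊤, by simp, fun k _ ω => Subsingleton.elim _ _⟩
  by_cases htr : MulAction.IsPretransitive G Ω
  · obtain ⟨M, f, hM, hf, hfM⟩ := MulAction.exists_fibration_of_isNilpotent (G := G) (Ω := Ω)
    have : Nontrivial (G ⧸ M) := by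
      rw [← not_subsingleton_iff_nontrivial]
      intro h
      exact hM (Subgroup.index_eq_one.1 (Nat.card_eq_one_iff_unique.2 ⟨h, ⟨(1 : G)⟩⟩))
    -- Here `S = G ⧸ M`, so that `M.index = Nat.card S` holds by definition.
    exact exists_subgroup_index_le_fixing_of_fibration M f hf hfM le_rfl
      fun X _ hlt => ih _ hlt rfl
  · have : Nontrivial (MulAction.orbitRel.Quotient G Ω) := by
      rw [← not_subsingleton_iff_nontrivial]
      exact fun h => htr ((MulAction.pretransitive_iff_subsingleton_quotient G Ω).2 h)
    -- An intransitive action is cut into its orbits, by the whole group.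
    exact exists_subgroup_index_le_fixing_of_fibration ⊤
      (Quotient.mk (MulAction.orbitRel G Ω)) Quotient.mk_surjective
      (fun m _ ω => Quotient.sound ⟨m, rfl⟩)
      (by rw [Subgroup.index_top]; exact Nat.card_pos)
      fun X _ hlt => ih _ hlt rfl

/-- A nilpotent permutation group of degree `n` has order at most `2 ^ (n - 1)`. -/
theorem Group.IsNilpotent.card_le_two_pow {G Ω : Type*} [Group G] [Finite G]
    [Group.IsNilpotent G] [Finite Ω] [Nonempty Ω] (φ : G →* Equiv.Perm Ω)
    (hφ : Function.Injective φ) : Nat.card G ≤ 2 ^ (Nat.card Ω - 1) := by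
  let _ : MulAction G Ω := MulAction.compHom Ω φ
  obtain ⟨K, hK, hfix⟩ := exists_subgroup_index_le_fixing_of_isNilpotent (G := G) (Ω := Ω)
  have hbot : K = ⊥ := (Subgroup.eq_bot_iff_forall K).2 fun k hk =>
    hφ ((Equiv.ext fun ω => hfix k hk ω).trans φ.map_one.symm)
  rwa [hbot, Subgroup.index_bot] at hK

/-! ### Nilpotent linear groups -/

/-- Unless a nilpotent group acts by scalars, some nonscalar `ρ x` commutes with the whole image up
to scalars. -/
theorem Representation.exists_comm_scalar {G V : Type*} [Group G] [Group.IsNilpotent G]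
    [AddCommGroup V] [Module ℂ V] (ρ : Representation ℂ G V) (h : ¬ ∀ g, ∃ c : ℂ, ρ g = c • 1) :
    ∃ x : G, (¬ ∃ c : ℂ, ρ x = c • 1) ∧ ∀ g, ∃ c : ℂ, ρ x * ρ g = c • (ρ g * ρ x) := by
  classical
  have hex : ∃ i, ∀ y ∈ (⊤ : Subgroup G).lowerCentralSeries i, ∃ c : ℂ, ρ y = c • 1 := by
    obtain ⟨n, hn⟩ := Subgroup.nilpotent_iff_lowerCentralSeries.1 ‹Group.IsNilpotent G›
    refine ⟨n, fun y hy => ⟨1, ?_⟩⟩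
    rw [hn, Subgroup.mem_bot] at hy
    rw [hy, map_one, one_smul]
  obtain ⟨i, hi⟩ : ∃ i, Nat.find hex = i + 1 := by
    refine Nat.exists_eq_succ_of_ne_zero fun h0 => h fun g => ?_
    exact (Nat.find_eq_zero hex).1 h0 g (Subgroup.mem_top g)
  -- The last term of the lower central series with a nonscalar element `x`: all commutators of `x`
  -- act by scalars.
  have hmin := Nat.find_min hex (m := i) (by omega)
  have hspec := Nat.find_spec hex
  rw [hi] at hspec
  push Not at hmin
  obtain ⟨x, hx, hxc⟩ := hmin
  refine ⟨x, fun ⟨c, hc⟩ => hxc c hc, fun g => ?_⟩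
  obtain ⟨c, hc⟩ := hspec (x * g * x⁻¹ * g⁻¹) (by
    rw [Subgroup.lowerCentralSeries_succ]
    exact Subgroup.commutator_mem_commutator hx (Subgroup.mem_top g))
  refine ⟨c, ?_⟩
  have h1 : x * g = (x * g * x⁻¹ * g⁻¹) * (g * x) := by group
  rw [← map_mul, h1, map_mul, hc, map_mul, smul_one_mul]

theorem Representation.isSemisimple_apply {G V : Type*} [Group G] [Finite G]
    [AddCommGroup V] [Module ℂ V] [FiniteDimensional ℂ V] (ρ : Representation ℂ G V) (x : G) :
    Module.End.IsSemisimple (ρ x) := by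
  refine Module.End.isSemisimple_of_squarefree_aeval_eq_zero
    (p := Polynomial.X ^ Nat.card G - 1) ?_ ?_
  · have : (Nat.card G : ℂ) ≠ 0 := Nat.cast_ne_zero.2 Nat.card_pos.ne'
    exact (Polynomial.separable_X_pow_sub_C (1 : ℂ) this one_ne_zero).squarefree
  · rw [map_sub, map_pow, Polynomial.aeval_X, ← map_pow, pow_card_eq_one', map_one,
      map_one, sub_self]

theorem iSupIndep.sum_finrank_le {K V ι : Type*} [Field K] [AddCommGroup V] [Module K V]
    [FiniteDimensional K V] [Fintype ι] {p : ι → Submodule K V} (hp : iSupIndep p) :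
    ∑ i, Module.finrank K (p i) ≤ Module.finrank K V := by
  classical
  rw [← Module.finrank_directSum]
  exact LinearMap.finrank_le_finrank_of_injective (f := DirectSum.coeLinearMap p)
    hp.dfinsupp_lsum_injective

/-- The elements of `G` whose action on `V` commutes with that of `x`: the preimage of the
centralizer of `ρ x`. -/
def Representation.centralizerOfApply {G V : Type*} [Group G]
    [AddCommGroup V] [Module ℂ V] (ρ : Representation ℂ G V) (x : G) : Subgroup G where
  carrier := {g | ρ x * ρ g = ρ g * ρ x}
  one_mem' := by simp
  mul_mem' {a b} ha hb := by
    change ρ x * ρ (a * b) = ρ (a * b) * ρ x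
    rw [map_mul]
    exact Commute.mul_right ha hb
  inv_mem' {a} ha := by
    change ρ x * ρ a⁻¹ = ρ a⁻¹ * ρ x
    have h1 : ρ a⁻¹ * ρ a = 1 := by rw [← map_mul, inv_mul_cancel, map_one]
    have h2 : ρ a * ρ a⁻¹ = 1 := by rw [← map_mul, mul_inv_cancel, map_one]
    have ha : ρ x * ρ a = ρ a * ρ x := ha
    calc ρ x * ρ a⁻¹ = ρ a⁻¹ * (ρ a * ρ x) * ρ a⁻¹ := by rw [← mul_assoc, h1, one_mul]
      _ = ρ a⁻¹ * ρ x := by rw [← ha, mul_assoc, mul_assoc, h2, mul_one]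

/-- If `ρ x` commutes with the image up to scalars `c g`, then multiplication by the `c g` permutes
the eigenvalues of `ρ x` freely, and `c g` determines the coset of `g` modulo the centralizer. -/
theorem Representation.index_centralizerOfApply_le {G V : Type*} [Group G]
    [AddCommGroup V] [Module ℂ V] [FiniteDimensional ℂ V] [Nontrivial V]
    (ρ : Representation ℂ G V) (x : G) (hx : ∀ g, ∃ c : ℂ, ρ x * ρ g = c • (ρ g * ρ x)) :
    (ρ.centralizerOfApply x).index ≤ Nat.card (Module.End.Eigenvalues (ρ x)) := by
  choose c hc using hx
  have hinj : ∀ (g : G) (v : V), ρ g v = 0 → v = 0 := fun g v h => by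
    rw [← ρ.inv_self_apply g v, h, map_zero]
  obtain ⟨l, hl⟩ := Module.End.exists_eigenvalue (ρ x)
  obtain ⟨v, hv⟩ := hl.exists_hasEigenvector
  have hl0 : l ≠ 0 := fun h0 => hv.2 (hinj x v (by rw [hv.apply_eq_smul, h0, zero_smul]))
  have hev : ∀ g, Module.End.HasEigenvalue (ρ x) (c g * l) := by
    intro g
    refine Module.End.hasEigenvalue_of_hasEigenvector (x := ρ g v)
      ⟨Module.End.mem_eigenspace_iff.2 ?_, fun h => hv.2 (hinj g v h)⟩
    have := LinearMap.congr_fun (hc g) v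
    simp only [Module.End.mul_apply, LinearMap.smul_apply, hv.apply_eq_smul, map_smul] at this
    rw [this, smul_smul]
  -- Inverses turn left cosets into right cosets, on which `c` is constant.
  let F : G ⧸ ρ.centralizerOfApply x → Module.End.Eigenvalues (ρ x) :=
    fun q => ⟨c q.out⁻¹ * l, hev _⟩
  refine Nat.card_le_card_of_injective F fun q r hqr => ?_
  have h1 : c q.out⁻¹ = c r.out⁻¹ := mul_right_cancel₀ hl0 (congrArg Subtype.val hqr)
  rw [← q.out_eq', ← r.out_eq']
  refine (QuotientGroup.eq.2 ?_).symm
  change ρ x * ρ (r.out⁻¹ * q.out) = ρ (r.out⁻¹ * q.out) * ρ x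
  have hq := hc q.out⁻¹
  have hr := hc r.out⁻¹
  rw [h1] at hq
  have e1 : ρ q.out⁻¹ * ρ q.out = 1 := by rw [← map_mul, inv_mul_cancel, map_one]
  have e2 : ρ q.out * ρ q.out⁻¹ = 1 := by rw [← map_mul, mul_inv_cancel, map_one]
  calc ρ x * ρ (r.out⁻¹ * q.out) = c r.out⁻¹ • (ρ r.out⁻¹ * ρ x) * ρ q.out := by
        rw [map_mul, ← mul_assoc, hr]
    _ = ρ r.out⁻¹ * (ρ q.out * (c r.out⁻¹ • (ρ q.out⁻¹ * ρ x))) * ρ q.out := by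
        rw [mul_smul_comm, ← mul_assoc (ρ q.out), e2, one_mul, mul_smul_comm]
    _ = ρ (r.out⁻¹ * q.out) * ρ x := by
        rw [← hq, map_mul]; simp only [mul_assoc, e1, mul_one]

/-- A finite nilpotent group acting linearly on an `n`-dimensional complex space has a subgroup of
index at most `2 ^ (n - 1)` with commutative image. -/
theorem Representation.exists_index_le_comm {G V : Type*} [Group G] [Finite G]
    [hG : Group.IsNilpotent G] [AddCommGroup V] [Module ℂ V] [FiniteDimensional ℂ V] [Nontrivial V]
    (ρ : Representation ℂ G V) :
    ∃ K : Subgroup G, K.index ≤ 2 ^ (Module.finrank ℂ V - 1) ∧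
      ∀ a ∈ K, ∀ b ∈ K, ρ a * ρ b = ρ b * ρ a := by
  induction hn : Module.finrank ℂ V using Nat.strong_induction_on generalizing G V with
  | _ n ih =>
  subst hn
  -- Otherwise `V` is the sum of the eigenspaces of a suitable `ρ x`, at least two in number.
  by_cases hsc : ∀ g, ∃ c : ℂ, ρ g = c • 1
  · refine ⟨⊤, by simp [Nat.one_le_two_pow], fun a _ b _ => ?_⟩
    obtain ⟨c, hc⟩ := hsc a
    rw [hc, smul_one_mul, mul_smul_one]
  obtain ⟨x, hx, hcomm⟩ := ρ.exists_comm_scalar hsc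
  let C := ρ.centralizerOfApply x
  let E : (Module.End.Eigenvalues (ρ x)) → Submodule ℂ V := fun s => Module.End.eigenspace (ρ x) s
  have hinv : ∀ (s : (Module.End.Eigenvalues (ρ x))) (g : C), ∀ v ∈ E s, ρ g v ∈ E s := by
    intro s g v hv
    have hv' := Module.End.mem_eigenspace_iff.1 hv
    refine Module.End.mem_eigenspace_iff.2 ?_
    have := LinearMap.congr_fun (show ρ x * ρ g = ρ g * ρ x from g.2) v
    rw [Module.End.mul_apply, Module.End.mul_apply, hv', map_smul] at this
    exact this
  let σ : ∀ s, Representation ℂ C (E s) := fun s =>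
    { toFun := fun g => (ρ g).restrict (hinv s g)
      map_one' := by ext; simp
      map_mul' := fun a b => by ext; simp }
  have hpos : ∀ s, Nontrivial (E s) := fun s => Submodule.nontrivial_iff_ne_bot.2 s.2
  have hlt : ∀ s, Module.finrank ℂ (E s) < Module.finrank ℂ V := by
    refine fun s => Submodule.finrank_lt fun h => hx ⟨s, LinearMap.ext fun v => ?_⟩
    exact Module.End.mem_eigenspace_iff.1 (show v ∈ E s from h ▸ Submodule.mem_top)
  choose K hK hKc using fun s => ih _ (hlt s) (σ s) rfl
  have : Nonempty (Module.End.Eigenvalues (ρ x)) :=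
    let ⟨l, hl⟩ := Module.End.exists_eigenvalue (ρ x)
    ⟨⟨l, hl⟩⟩
  refine ⟨(⨅ s, K s).map C.subtype, Subgroup.index_map_iInf_le_two_pow C K
    (fun s => Module.finrank ℂ (E s)) _ (ρ.index_centralizerOfApply_le x hcomm)
    (fun s => Module.finrank_pos) hK ?_, ?_⟩
  · rw [finsum_eq_sum_of_fintype]
    exact iSupIndep.sum_finrank_le
      ((Module.End.eigenspaces_iSupIndep (ρ x)).comp Subtype.val_injective)
  · rintro _ ⟨a, ha, rfl⟩ _ ⟨b, hb, rfl⟩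
    refine LinearMap.ext fun v => ?_
    have hv : v ∈ ⨆ μ, Module.End.eigenspace (ρ x) μ := by
      rw [(ρ.isSemisimple_apply x).iSup_eigenspace_eq_top]; exact Submodule.mem_top
    induction hv using Submodule.iSup_induction' with
    | mem μ v hv =>
      by_cases hv0 : v = 0
      · simp [hv0]
      have hμ : Module.End.HasEigenvalue (ρ x) μ :=
        Module.End.hasEigenvalue_of_hasEigenvector ⟨hv, hv0⟩
      have := LinearMap.congr_fun (hKc ⟨μ, hμ⟩ a (Subgroup.mem_iInf.1 ha _) b
        (Subgroup.mem_iInf.1 hb _)) ⟨v, hv⟩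
      exact congrArg Subtype.val this
    | zero => simp
    | add v w _ _ hv hw => rw [map_add, map_add, hv, hw]

/-! ### Characteristic abelian subgroups of small index -/

/-- The product set `HK` has `|H| |K| / |H ⊓ K|` elements and lies in `H ⊔ K`. -/
theorem Subgroup.card_mul_card_le {G : Type*} [Group G] [Finite G] (H K : Subgroup G) :
    Nat.card H * Nat.card K ≤ Nat.card (H ⊔ K : Subgroup G) * Nat.card (H ⊓ K : Subgroup G) := by
  have h1 : Nat.card (H ⊓ K : Subgroup G) * H.relIndex K = Nat.card K := by
    rw [← Subgroup.inf_relIndex_right H K]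
    rw [← Subgroup.relIndex_bot_left, ← Subgroup.relIndex_bot_left]
    exact Subgroup.relIndex_mul_relIndex _ _ _ bot_le inf_le_right
  have h2 : Nat.card H * H.relIndex (H ⊔ K) = Nat.card (H ⊔ K : Subgroup G) := by
    rw [← Subgroup.relIndex_bot_left, ← Subgroup.relIndex_bot_left]
    exact Subgroup.relIndex_mul_relIndex _ _ _ bot_le le_sup_left
  have h3 : H.relIndex K ≤ H.relIndex (H ⊔ K) :=
    Subgroup.relIndex_le_of_le_right le_sup_right Subgroup.index_ne_zero_of_finite
  rw [← h1, ← h2]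
  calc Nat.card H * (Nat.card (H ⊓ K : Subgroup G) * H.relIndex K)
      = Nat.card H * H.relIndex K * Nat.card (H ⊓ K : Subgroup G) := by ring
    _ ≤ _ := by gcongr

/-- The Chermak–Delgado measure `|H| |C_G(H)|` of a subgroup `H` of a finite group. -/
noncomputable def Subgroup.chermakDelgadoMeasure {G : Type*} [Group G] (H : Subgroup G) : ℕ :=
  Nat.card H * Nat.card (Subgroup.centralizer (H : Set G))

theorem Subgroup.chermakDelgadoMeasure_mul_le {G : Type*} [Group G] [Finite G]
    (H K : Subgroup G) :
    H.chermakDelgadoMeasure * K.chermakDelgadoMeasure ≤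
      (H ⊔ K).chermakDelgadoMeasure * (H ⊓ K).chermakDelgadoMeasure := by
  have h1 := Subgroup.card_mul_card_le H K
  have h2 := Subgroup.card_mul_card_le (Subgroup.centralizer (H : Set G))
    (Subgroup.centralizer (K : Set G))
  have h3 : Nat.card (Subgroup.centralizer (H : Set G) ⊔ Subgroup.centralizer (K : Set G) :
      Subgroup G) ≤ Nat.card (Subgroup.centralizer ((H ⊓ K : Subgroup G) : Set G)) :=
    Subgroup.card_le_of_le (sup_le (Subgroup.centralizer_le inf_le_left)
      (Subgroup.centralizer_le inf_le_right))
  have h4 : Nat.card (Subgroup.centralizer (H : Set G) ⊓ Subgroup.centralizer (K : Set G) :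
      Subgroup G) ≤ Nat.card (Subgroup.centralizer ((H ⊔ K : Subgroup G) : Set G)) := by
    refine Subgroup.card_le_of_le (Subgroup.le_centralizer_iff.1 (sup_le ?_ ?_))
    · exact Subgroup.le_centralizer_iff.1 inf_le_left
    · exact Subgroup.le_centralizer_iff.1 inf_le_right
  unfold Subgroup.chermakDelgadoMeasure
  calc _ = (Nat.card H * Nat.card K) * (Nat.card (Subgroup.centralizer (H : Set G)) *
        Nat.card (Subgroup.centralizer (K : Set G))) := by ring
    _ ≤ _ := Nat.mul_le_mul h1 (h2.trans (Nat.mul_le_mul h3 h4))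
    _ = _ := by ring

/-- The Chermak–Delgado theorem: the least subgroup `M` of maximal measure is characteristic, and
abelian because its centralizer also has maximal measure. Comparing measures with an abelian `A`
gives `|A| ^ 2 ≤ |M| |G|`. -/
theorem Subgroup.exists_characteristic_isMulCommutative {G : Type*} [Group G] [Finite G]
    (A : Subgroup G) [IsMulCommutative A] :
    ∃ M : Subgroup G, M.Characteristic ∧ IsMulCommutative M ∧ M.index ≤ A.index ^ 2 := by
  obtain ⟨H₀, hH₀⟩ := Finite.exists_max (Subgroup.chermakDelgadoMeasure (G := G))
  -- `M` has minimal order among the subgroups of maximal measure.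
  obtain ⟨M, hM, hmin⟩ := Set.exists_min_image
    {H : Subgroup G | ∀ K : Subgroup G, K.chermakDelgadoMeasure ≤ H.chermakDelgadoMeasure}
    (fun H => Nat.card H) (Set.toFinite _) ⟨H₀, hH₀⟩
  have hpos : ∀ H : Subgroup G, 0 < H.chermakDelgadoMeasure :=
    fun H => Nat.mul_pos Nat.card_pos Nat.card_pos
  -- If `H` has maximal measure, so has `M ⊓ H`; by minimality `M ≤ H`.
  have hle : ∀ H : Subgroup G, M.chermakDelgadoMeasure ≤ H.chermakDelgadoMeasure → M ≤ H := by
    intro H hH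
    have h1 := Subgroup.chermakDelgadoMeasure_mul_le M H
    have h2 : M.chermakDelgadoMeasure ≤ (M ⊓ H).chermakDelgadoMeasure := by
      refine Nat.le_of_mul_le_mul_left (?_ : M.chermakDelgadoMeasure * _ ≤ _) (hpos M)
      exact ((Nat.mul_le_mul_left _ hH).trans h1).trans (Nat.mul_le_mul_right _ (hM _))
    have h3 := hmin (M ⊓ H) fun K => (hM K).trans h2
    exact inf_eq_left.1 (Subgroup.eq_of_le_of_card_ge inf_le_left h3)
  refine ⟨M, Subgroup.characteristic_iff_le_map.2 fun φ => hle _ ?_,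
    Subgroup.le_centralizer_iff_isMulCommutative.1 (hle _ ?_), ?_⟩
  · have hφ : Function.Injective φ.toMonoidHom := φ.injective
    refine Nat.mul_le_mul (Subgroup.card_map_of_injective hφ).ge ?_
    rw [← Subgroup.card_map_of_injective (K := Subgroup.centralizer (M : Set G)) hφ]
    exact Subgroup.card_le_of_le (Subgroup.map_centralizer_le_centralizer_image _ _)
  · unfold Subgroup.chermakDelgadoMeasure
    rw [mul_comm]
    exact Nat.mul_le_mul_left _
      (Subgroup.card_le_of_le (Subgroup.le_centralizer_iff.1 le_rfl))
  · have h1 : Nat.card A * Nat.card A ≤ Nat.card M * Nat.card G :=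
      calc Nat.card A * Nat.card A ≤ A.chermakDelgadoMeasure :=
            Nat.mul_le_mul_left _ (Subgroup.card_le_of_le (Subgroup.le_centralizer A))
        _ ≤ M.chermakDelgadoMeasure := hM A
        _ ≤ Nat.card M * Nat.card G := Nat.mul_le_mul_left _ (Subgroup.card_le_card_group _)
    have hA := A.card_mul_index
    have hMi := M.card_mul_index
    have hA0 : 0 < Nat.card A := Nat.card_pos
    have hM0 : 0 < Nat.card M := Nat.card_pos
    have h2 : (Nat.card A * Nat.card A) * M.index ≤ (Nat.card A * Nat.card A) * A.index ^ 2 :=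
      calc _ ≤ Nat.card M * Nat.card G * M.index := Nat.mul_le_mul_right _ h1
        _ = Nat.card G * (Nat.card M * M.index) := by ring
        _ = (Nat.card A * A.index) * (Nat.card A * A.index) := by rw [hMi, hA]
        _ = _ := by ring
    exact Nat.le_of_mul_le_mul_left h2 (Nat.mul_pos hA0 hA0)

/-! ### The Fitting subgroup -/

theorem Subgroup.eq_top_of_forall_exists_sylow_le {G : Type*} [Group G] [Finite G]
    (H : Subgroup G)
    (h : ∀ p : ℕ, p.Prime → p ∣ Nat.card G → ∃ P : Sylow p G, (P : Subgroup G) ≤ H) : H = ⊤ := by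
  rw [← Subgroup.index_eq_one]
  by_contra hne
  obtain ⟨p, hp, hdvd⟩ := Nat.exists_prime_and_dvd hne
  have := Fact.mk hp
  obtain ⟨P, hP⟩ := h p hp (hdvd.trans H.index_dvd_card)
  exact P.not_dvd_index (hdvd.trans (Subgroup.index_dvd_of_le hP))

theorem IsPGroup.le_normalCore_sylow {G : Type*} [Group G] [Finite G] {p : ℕ} [Fact p.Prime]
    {N : Subgroup G} [N.Normal] (hN : IsPGroup p N) (P : Sylow p G) :
    N ≤ (P : Subgroup G).normalCore :=
  Subgroup.normal_le_normalCore.2 <| sup_eq_right.1 <|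
    P.is_maximal' (hN.to_sup_of_normal_left P.isPGroup') le_sup_right

/-- Fitting's theorem for finite groups: the Fitting subgroup lies in the product of the largest
normal `p`-subgroups, which commute pairwise, so that this product is nilpotent. -/
theorem isNilpotent_fittingSubgroup {G : Type*} [Group G] [Finite G] :
    Group.IsNilpotent (fittingSubgroup G) := by
  -- `O p` is the largest normal `p`-subgroup, the intersection of all Sylow `p`-subgroups.
  let ι := (Nat.card G).primeFactors
  have hp : ∀ p : ι, Fact (p : ℕ).Prime := fun p => ⟨Nat.prime_of_mem_primeFactors p.2⟩
  let O : ι → Subgroup G := fun p => ((default : Sylow p G) : Subgroup G).normalCore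
  have hO : ∀ p : ι, IsPGroup (p : ℕ) (O p) := fun p =>
    (default : Sylow p G).isPGroup'.to_le (Subgroup.normalCore_le _)
  have hOn : ∀ p, (O p).Normal := fun p => inferInstance
  have hcomm : Pairwise fun p q => ∀ x y : G, x ∈ O p → y ∈ O q → Commute x y := by
    intro p q hpq x y hx hy
    exact Subgroup.commute_of_normal_of_disjoint _ _ (hOn p) (hOn q)
      (IsPGroup.disjoint_of_ne p q (fun h => hpq (Subtype.ext h)) _ _ (hO p) (hO q)) x y hx hy
  have hnil : Group.IsNilpotent (⨆ p, O p : Subgroup G) := by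
    have : ∀ p, Group.IsNilpotent (O p) := fun p => (hO p).isNilpotent
    rw [← Subgroup.noncommPiCoprod_range (hcomm := hcomm)]
    exact Group.nilpotent_of_surjective _ (MonoidHom.rangeRestrict_surjective _)
  refine Group.nilpotent_of_mulEquiv (Subgroup.subgroupOfEquivOfLe (K := ⨆ p, O p) ?_)
  -- The Sylow subgroups of a nilpotent normal `N` are characteristic in `N`, hence normal in `G`.
  refine sSup_le fun N ⟨hN, hNnil⟩ => ?_
  rw [← Subgroup.subgroupOf_eq_top]
  refine Subgroup.eq_top_of_forall_exists_sylow_le _ fun p hpp hdvd => ?_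
  have := Fact.mk hpp
  obtain ⟨P⟩ : Nonempty (Sylow p N) := inferInstance
  refine ⟨P, ?_⟩
  have hchar : (P : Subgroup N).Characteristic := P.characteristic_of_normal inferInstance
  have hnorm : ((P : Subgroup N).map N.subtype).Normal := inferInstance
  have hPp : IsPGroup p ((P : Subgroup N).map N.subtype) := P.isPGroup'.map _
  refine Subgroup.map_le_iff_le_comap.1 ?_
  have hmem : p ∈ (Nat.card G).primeFactors :=
    Nat.mem_primeFactors.2 ⟨hpp, hdvd.trans N.card_subgroup_dvd_card, Nat.card_pos.ne'⟩
  exact (hPp.le_normalCore_sylow default).trans (le_iSup O ⟨p, hmem⟩)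

theorem IsMulCommutative.isNilpotent {G : Type*} [Group G] [IsMulCommutative G] :
    Group.IsNilpotent G :=
  let _ : CommGroup G := { ‹Group G› with mul_comm := mul_comm' }
  inferInstance

theorem le_fittingSubgroup {G : Type*} [Group G] {A : Subgroup G} (hA : A.Normal)
    (hAc : IsMulCommutative A) : A ≤ fittingSubgroup G :=
  le_sSup ⟨hA, IsMulCommutative.isNilpotent⟩

/-! ### Abelian normal subgroups of maximal order -/

theorem exists_isMaxOrderAbelianNormal (G : Type*) [Group G] [Finite G] :
    ∃ A : Subgroup G, IsMaxOrderAbelianNormal A := by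
  obtain ⟨A, hA, hmax⟩ := Set.exists_max_image {A : Subgroup G | A.Normal ∧ IsMulCommutative A}
    (fun A => Nat.card A) (Set.toFinite _) ⟨⊥, inferInstance, inferInstance⟩
  exact ⟨A, hA, fun B hB hBc => hmax B ⟨hB, hBc⟩⟩

theorem IsMaxOrderAbelianNormal.index_le {G : Type*} [Group G] [Finite G] {A B : Subgroup G}
    (hA : IsMaxOrderAbelianNormal A) (hB : B.Normal) (hBc : IsMulCommutative B) :
    A.index ≤ B.index := by
  have h := hA.2 B hB hBc
  refine Nat.le_of_mul_le_mul_left (?_ : Nat.card B * _ ≤ _) Nat.card_pos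
  rw [B.card_mul_index, ← A.card_mul_index]
  exact Nat.mul_le_mul_right _ h

theorem Group.IsNilpotent.exists_isMulCommutative_index_le {G : Type*} [Group G] [Finite G]
    [Group.IsNilpotent G] {n : ℕ} (hn : n ≠ 0) (φ : G →* Matrix.GeneralLinearGroup (Fin n) ℂ)
    (hφ : Function.Injective φ) :
    ∃ A : Subgroup G, IsMulCommutative A ∧ A.index ≤ 2 ^ (n - 1) := by
  have : Nonempty (Fin n) := ⟨⟨0, Nat.pos_of_ne_zero hn⟩⟩
  let ρ : Representation ℂ G (Fin n → ℂ) :=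
    ((Matrix.toLinAlgEquiv' : Matrix (Fin n) (Fin n) ℂ ≃ₐ[ℂ] _) : _ →* _).comp
      ((Units.coeHom _).comp φ)
  have hρ : Function.Injective ρ :=
    Matrix.toLinAlgEquiv'.injective.comp (Units.val_injective.comp hφ)
  obtain ⟨K, hK, hcomm⟩ := ρ.exists_index_le_comm
  refine ⟨K, ⟨⟨fun a b => Subtype.ext (hρ ?_)⟩⟩, by simpa using hK⟩
  rw [Subgroup.coe_mul, Subgroup.coe_mul, map_mul, map_mul, hcomm a a.2 b b.2]

/-- The nilpotent group `F(G)` has an abelian subgroup of index at most `2 ^ (n - 1)`, hence a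
characteristic one, normal in `G`, of index at most `4 ^ (n - 1)`. -/
theorem IsMaxOrderAbelianNormal.index_le_four_pow_mul {n : ℕ} (hn : n ≠ 0)
    {G : Subgroup (Matrix.GeneralLinearGroup (Fin n) ℂ)} [Finite G] {A : Subgroup G}
    (hA : IsMaxOrderAbelianNormal A) :
    A.index ≤ 4 ^ (n - 1) * (fittingSubgroup G).index := by
  have hnil := isNilpotent_fittingSubgroup (G := G)
  obtain ⟨B, hB, hBi⟩ := Group.IsNilpotent.exists_isMulCommutative_index_le hn
    (G.subtype.comp (fittingSubgroup G).subtype)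
    (G.subtype_injective.comp (fittingSubgroup G).subtype_injective)
  obtain ⟨M, hM, hMc, hMi⟩ := B.exists_characteristic_isMulCommutative
  have hF : (fittingSubgroup G).Normal :=
    Subgroup.sSup_normal _ fun N hN => hN.1
  calc A.index ≤ (M.map (fittingSubgroup G).subtype).index :=
        hA.index_le inferInstance inferInstance
    _ = M.index * (fittingSubgroup G).index := Subgroup.index_map_subtype M
    _ ≤ 4 ^ (n - 1) * (fittingSubgroup G).index := by
        refine Nat.mul_le_mul_right _ (hMi.trans ((Nat.pow_le_pow_left hBi 2).trans_eq ?_))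
        rw [← pow_mul, mul_comm, pow_mul]
        norm_num

/-! ### Comparing the three sets -/

/-- The permutation matrices, as a homomorphism to `GL(n, ℂ)`. -/
def permToGL (n : ℕ) : Equiv.Perm (Fin n) →* Matrix.GeneralLinearGroup (Fin n) ℂ :=
  (Matrix.permMatrixHom (n := Fin n) (R := ℂ)).toHomUnits

theorem permToGL_injective (n : ℕ) : Function.Injective (permToGL n) := by
  refine (injective_iff_map_eq_one _).2 fun σ hσ => inv_eq_one.1 (Equiv.ext fun i => ?_)
  have h : (σ⁻¹ : Equiv.Perm (Fin n)).permMatrix ℂ = (1 : Equiv.Perm (Fin n)).permMatrix ℂ :=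
    (congrArg Units.val hσ).trans Matrix.permMatrix_one.symm
  have h2 := DFunLike.congr_fun (PEquiv.toMatrix_injective h) i
  exact Option.some_injective _ h2

theorem rpow_one_div_le_mul {a c i n : ℕ} (hn : 2 ≤ n) (h : a ≤ c ^ (n - 1) * i) :
    (a : ℝ) ^ (1 / ((n : ℝ) - 1)) ≤ c * (i : ℝ) ^ (1 / ((n : ℝ) - 1)) := by
  have hn1 : ((n - 1 : ℕ) : ℝ) = (n : ℝ) - 1 := by push_cast [Nat.cast_sub (by omega : 1 ≤ n)]; ring
  have h0 : n - 1 ≠ 0 := by omega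
  rw [← hn1, one_div]
  calc (a : ℝ) ^ (((n - 1 : ℕ) : ℝ)⁻¹)
      ≤ ((c : ℝ) ^ (n - 1) * i) ^ (((n - 1 : ℕ) : ℝ)⁻¹) :=
        Real.rpow_le_rpow (by positivity) (by exact_mod_cast h) (by positivity)
    _ = _ := by
        rw [Real.mul_rpow (by positivity) (by positivity),
          Real.pow_rpow_inv_natCast (by positivity) h0]

theorem exists_mem_setA_two_mul_ge {Q : FiniteGroupProperty} (hQ : IsNormallyHereditary Q)
    {x : ℝ} (hx : x ∈ setB Q) : ∃ y ∈ setA Q, x ≤ 2 * y := by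
  obtain ⟨n, hn, G, hG, rfl⟩ := hx
  have : Nonempty (Fin n) := ⟨⟨0, by omega⟩⟩
  let e : G ≃* G.map (permToGL n) := G.equivMapOfInjective _ (permToGL_injective n)
  have hfin : Finite (G.map (permToGL n)) := Finite.of_equiv _ e.toEquiv
  have hnil := isNilpotent_fittingSubgroup (G := G.map (permToGL n))
  refine ⟨_, ⟨n, hn, G.map (permToGL n), hfin, hQ.of_mulEquiv _ _ ⟨e⟩ hG, rfl⟩, ?_⟩
  refine mod_cast rpow_one_div_le_mul (c := 2) hn ?_
  have hcard := Group.IsNilpotent.card_le_two_pow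
    ((G.subtype.comp e.symm.toMonoidHom).comp (fittingSubgroup (G.map (permToGL n))).subtype)
    ((G.subtype_injective.comp e.symm.injective).comp (Subgroup.subtype_injective _))
  rw [Nat.card_fin] at hcard
  rw [Nat.card_congr e.toEquiv, ← (fittingSubgroup (G.map (permToGL n))).card_mul_index]
  exact Nat.mul_le_mul_right _ hcard

theorem exists_mem_setA_four_mul_ge {Q : FiniteGroupProperty}
    {x : ℝ} (hx : x ∈ setC Q) : ∃ y ∈ setA Q, x ≤ 4 * y := by
  obtain ⟨n, hn, G, hfin, hG, A, hA, rfl⟩ := hx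
  exact ⟨_, ⟨n, hn, G, hfin, hG, rfl⟩,
    mod_cast rpow_one_div_le_mul (c := 4) hn (hA.index_le_four_pow_mul (by omega))⟩

theorem exists_mem_setC_ge {Q : FiniteGroupProperty}
    {x : ℝ} (hx : x ∈ setA Q) : ∃ y ∈ setC Q, x ≤ y := by
  obtain ⟨n, hn, G, hfin, hG, rfl⟩ := hx
  obtain ⟨A, hA⟩ := exists_isMaxOrderAbelianNormal G
  refine ⟨_, ⟨n, hn, G, hfin, hG, A, hA, rfl⟩, ?_⟩
  have h := Subgroup.index_antitone (le_fittingSubgroup hA.1.1 hA.1.2)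
  simpa using rpow_one_div_le_mul (c := 1) hn (by simpa using h)

theorem IsNormallyHereditary.of_subsingleton {Q : FiniteGroupProperty}
    (hQ : IsNormallyHereditary Q) (hext : IsExtant Q) (G : Type) [Group G] [Finite G]
    [Subsingleton G] : Q G := by
  obtain ⟨H, _, _, hH⟩ := hext
  have h := hQ.of_normalSection H ⊤ ⊤ hH
  have : Unique G := uniqueOfSubsingleton 1
  have := QuotientGroup.subsingleton_quotient_top (G := (⊤ : Subgroup H))
  have : Unique ((⊤ : Subgroup H) ⧸ (⊤ : Subgroup (⊤ : Subgroup H))) := uniqueOfSubsingleton 1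
  exact hQ.of_mulEquiv _ _ ⟨MulEquiv.ofUnique⟩ h

theorem lemma2p1 (Q : FiniteGroupProperty) (hQ : IsNormallyHereditary Q) (hext : IsExtant Q) :
    (BddAbove (setA Q) ↔ BddAbove (setC Q)) ∧
    (BddAbove (setA Q) ∨ BddAbove (setC Q) →
      BddAbove (setB Q) ∧
      ∃ α β γ : ℝ, IsLUB (setA Q) α ∧ IsLUB (setB Q) β ∧ IsLUB (setC Q) γ ∧
        β ≤ 2 * α ∧ γ ≤ 4 * α) := by
  have hB : ∀ a ∈ upperBounds (setA Q), 2 * a ∈ upperBounds (setB Q) := fun a ha x hx => by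
    obtain ⟨y, hy, hxy⟩ := exists_mem_setA_two_mul_ge hQ hx
    linarith [ha hy]
  have hC : ∀ a ∈ upperBounds (setA Q), 4 * a ∈ upperBounds (setC Q) := fun a ha x hx => by
    obtain ⟨y, hy, hxy⟩ := exists_mem_setA_four_mul_ge hx
    linarith [ha hy]
  have hA : BddAbove (setC Q) → BddAbove (setA Q) := fun ⟨c, hc⟩ => ⟨c, fun x hx => by
    obtain ⟨y, hy, hxy⟩ := exists_mem_setC_ge hx
    exact hxy.trans (hc hy)⟩
  have hiff : BddAbove (setA Q) ↔ BddAbove (setC Q) := ⟨fun ⟨a, ha⟩ => ⟨_, hC a ha⟩, hA⟩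
  refine ⟨hiff, fun h => ?_⟩
  have hbA : BddAbove (setA Q) := h.elim id hA
  have hneA : (setA Q).Nonempty :=
    ⟨_, 2, le_rfl, ⊥, inferInstance, hQ.of_subsingleton hext _, rfl⟩
  have hneB : (setB Q).Nonempty := ⟨_, 2, le_rfl, ⊥, hQ.of_subsingleton hext _, rfl⟩
  have hneC : (setC Q).Nonempty := let ⟨_, hx⟩ := hneA; (exists_mem_setC_ge hx).imp fun _ h => h.1
  have hα := isLUB_csSup hneA hbA
  have hβ := isLUB_csSup hneB ⟨_, hB _ hα.1⟩
  have hγ := isLUB_csSup hneC ⟨_, hC _ hα.1⟩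
  exact ⟨⟨_, hB _ hα.1⟩, _, _, _, hα, hβ, hγ, hβ.2 (hB _ hα.1), hγ.2 (hC _ hα.1)⟩
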